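/- Let $k$ be an arbitrary field, let $B$ and $R$ be affine $k$-domains (that is, commutative integral domains that are finitely generated as $k$-algebras), let $N\ge 0$ be an integer, and let $\Psi: B\to R[X]=R[X_1,\dots,X_N]$ be a homomorphism of $k$-algebras. For each $\mathfrak p\in\operatorname{Spec} R$, write $\kappa(\mathfrak p)=R_{\mathfrak p}/\mathfrak pR_{\mathfrak p}$, let $\Psi^{\mathfrak p}: B\to\kappa(\mathfrak p)[X]=\kappa(\mathfrak p)[X_1,\dots,X_N]$ be the composition of $\Psi$ with the homomorphism $R[X]\to\kappa(\mathfrak p)[X]$ that applies the canonical map $R\to\kappa(\mathfrak p)$ to the coefficients and fixes every $X_i$, and let $\hat\Psi^{\mathfrak p}:\kappa(\mathfrak p)\otimes_k B\to\kappa(\mathfrak p)[X]$ be the induced homomorphism of $\kappa(\mathfrak p)$-algebras, $c\otimes b\mapsto c\,\Psi^{\mathfrak p}(b)$. Let $$\mathcal X_k(\Psi)=\{\mathfrak p\in\operatorname{Spec}R : \hat\Psi^{\mathfrak p}\text{ is injective}\}.$$ Then: (a) $\mathcal X_k(\Psi)$ is a constructible subset of $\operatorname{Spec} R$. (b) If $B$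 is geometrically integral (that is, $K\otimes_k B$ is a domain for every extension field $K$ of $k$) and $\mathfrak m$ is a maximal ideal of $R$, then $\mathfrak m\in\mathcal X_k(\Psi)$ if and only if $\Psi^{\mathfrak m}$ is injective. -/

import Mathlib

open scoped TensorProduct

/-- The `k`-algebra `B` is geometrically integral: `K ⊗[k] B` is a domain for every extension
field `K` of `k`. The extensions range over the universe of `k`; since it contains an algebraic
closure of `k`, the condition for these `K` is the same as for extension fields in any universe. -/
def IsGeometricallyIntegralAlgebra.{u, v} (k : Type u) (B : Type v) [Field k] [CommRing B]
    [Algebra k B] : Prop :=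
  ∀ (K : Type u) [Field K] [Algebra k K], IsDomain (K ⊗[k] B)

noncomputable section

universe u v w

variable {k : Type u} {B : Type v} {R : Type w} [Field k] [CommRing B] [Algebra k B]
  [CommRing R] [Algebra k R] {N : ℕ}

/-- The `k`-homomorphism `B → κ(p)[X₁, …, X_N]`: the composition of
`Ψ : B → R[X₁, …, X_N]` with the map `R[X₁, …, X_N] → κ(p)[X₁, …, X_N]` which reduces
coefficients along the canonical homomorphism `R → κ(p)` and sends each `Xᵢ` to itself. -/
def fiberHom (Ψ : B →ₐ[k] MvPolynomial (Fin N) R) (p : PrimeSpectrum R) :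
    B →ₐ[k] MvPolynomial (Fin N) p.asIdeal.ResidueField :=
  (MvPolynomial.mapAlgHom (IsScalarTower.toAlgHom k R p.asIdeal.ResidueField)).comp Ψ

/-- The induced `κ(p)`-homomorphism `κ(p) ⊗[k] B → κ(p)[X₁, …, X_N]`, given by the
universal property of the tensor product: `c ⊗ b ↦ c • fiberHom Ψ p b`. -/
def fiberHomHat (Ψ : B →ₐ[k] MvPolynomial (Fin N) R) (p : PrimeSpectrum R) :
    p.asIdeal.ResidueField ⊗[k] B →ₐ[p.asIdeal.ResidueField]
      MvPolynomial (Fin N) p.asIdeal.ResidueField :=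
  Algebra.TensorProduct.lift (Algebra.ofId _ _) (fiberHom Ψ p) (fun _ _ => Commute.all _ _)

/-- The set of primes `p` of `R` for which `κ(p) ⊗[k] B → κ(p)[X₁, …, X_N]` is injective. -/
def polynomialEmbeddingLocus (Ψ : B →ₐ[k] MvPolynomial (Fin N) R) : Set (PrimeSpectrum R) :=
  {p | Function.Injective (fiberHomHat Ψ p)}

end

/-! For (a), Noetherian induction reduces to a generic dichotomy over the domain `R/p`: after
inverting one element, injectivity holds at all points or at none. A nonzero kernel element of `Φ :
R ⊗ B → R[X]` stays nonzero wherever one of its coordinates does. If `Φ` is injective, `A = R ⊗ B`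
is a domain and there is an `A`-linear `ν : R[X] → A_a` with `ν 1 ≠ 0`. Its base change composed
with the base change of `Φ` is multiplication by `ν 1`, so injectivity persists as long as `a` and
the numerator of `ν 1` remain nonzerodivisors, which is again a generic condition.

For (b), `κ(m)` is finite over `k`, so `κ(m) ⊗ B` is a domain integral over `B`, and a nonzero ideal
of it meets `B` nontrivially. -/

/-! ### Functionals on finite extensions. -/

/-- Split `Frac P → Frac S` linearly, then clear the denominators of the values on finitely many
generators of `S`. -/
theorem LinearMap.exists_dual_apply_one_ne_zero {P S : Type*} [CommRing P] [IsDomain P] [CommRing S]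
    [IsDomain S] [Algebra P S] [FaithfulSMul P S] [Module.Finite P S] :
    ∃ μ : S →ₗ[P] P, μ 1 ≠ 0 := by
  classical
  let Q := FractionRing P
  let K := FractionRing S
  let : Algebra Q K := FractionRing.liftAlgebra P K
  have : IsScalarTower P Q K := FractionRing.isScalarTower_liftAlgebra P K
  obtain ⟨ν, hν⟩ := (Algebra.linearMap Q K).exists_leftInverse_of_injective
    (LinearMap.ker_eq_bot.2 (algebraMap Q K).injective)
  have hν1 : ν 1 = 1 := by simpa using LinearMap.congr_fun hν 1
  let ν' : S →ₗ[P] Q := (ν.restrictScalars P) ∘ₗ (IsScalarTower.toAlgHom P S K).toLinearMap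
  obtain ⟨w, hw⟩ := Module.Finite.fg_top (R := P) (M := S)
  obtain ⟨d, hd⟩ := IsLocalization.exist_integer_multiples_of_finset (nonZeroDivisors P)
    (w.image ν')
  have key : ∀ z : S, ((d : P) • ν') z ∈ LinearMap.range (Algebra.linearMap P Q) := by
    intro z
    have hz : z ∈ Submodule.span P (w : Set S) := hw ▸ Submodule.mem_top
    induction hz using Submodule.span_induction with
    | mem x hx =>
      obtain ⟨y, hy⟩ := hd (ν' x) (Finset.mem_image_of_mem _ hx)
      exact ⟨y, by simpa using hy⟩
    | zero => simp
    | add x y _ _ hx hy => rw [map_add]; exact add_mem hx hy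
    | smul c x _ hx => rw [map_smul]; exact Submodule.smul_mem _ _ hx
  let e := LinearEquiv.ofInjective (Algebra.linearMap P Q) (IsFractionRing.injective P Q)
  refine ⟨e.symm.toLinearMap ∘ₗ ((d : P) • ν').codRestrict _ key, ?_⟩
  simp only [LinearMap.comp_apply, LinearEquiv.coe_coe, ne_eq, LinearEquiv.map_eq_zero_iff]
  intro h
  have := congrArg Subtype.val h
  simp [ν', hν1, Algebra.smul_def] at this

/-! ### Constructibility by Noetherian induction. -/

theorem PrimeSpectrum.isConstructible_of_forall_exists_basicOpen {R : Type*} [CommRing R]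
    [IsNoetherianRing R] (C : Set (PrimeSpectrum R))
    (h : ∀ p : PrimeSpectrum R, ∃ r ∉ p.asIdeal,
      (∀ q : PrimeSpectrum R, p ≤ q → r ∉ q.asIdeal → q ∈ C) ∨
      (∀ q : PrimeSpectrum R, p ≤ q → r ∉ q.asIdeal → q ∉ C)) :
    Topology.IsConstructible C := by
  have hopen (U : Set (PrimeSpectrum R)) (hU : IsOpen U) : Topology.IsConstructible U :=
    (TopologicalSpace.NoetherianSpace.isCompact U).isConstructible hU
  have hclosed (U : Set (PrimeSpectrum R)) (hU : IsClosed U) : Topology.IsConstructible U :=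
    (hopen _ hU.isOpen_compl).of_compl
  suffices H : ∀ I : Ideal R, Topology.IsConstructible (C ∩ zeroLocus (I : Set R)) by
    simpa using H ⊥
  intro (I : Ideal R)
  induction I using IsNoetherian.induction with
  | hgt I ih =>
  change Ideal R at I
  have lt_sup {x : R} (hx : x ∉ I) : I < I ⊔ Ideal.span {x} :=
    left_lt_sup.2 fun hle ↦ hx (hle (Ideal.mem_span_singleton_self x))
  have mem_sup {x : R} {q : PrimeSpectrum R} :
      q ∈ zeroLocus ((I ⊔ Ideal.span {x} : Ideal R) : Set R) ↔
        I ≤ q.asIdeal ∧ x ∈ q.asIdeal := by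
    simp [mem_zeroLocus, Ideal.span_le]
  have mem_I {q : PrimeSpectrum R} : q ∈ zeroLocus (I : Set R) ↔ I ≤ q.asIdeal := by
    simp [mem_zeroLocus]
  by_cases htop : I = ⊤
  · simp [htop]
  by_cases hp : I.IsPrime
  · obtain ⟨r, hr, hC⟩ := h ⟨I, hp⟩
    have hr' := ih _ (lt_sup hr)
    have hlc : Topology.IsConstructible
        (zeroLocus (I : Set R) ∩ (basicOpen r : Set (PrimeSpectrum R))) :=
      (hclosed _ (isClosed_zeroLocus _)).inter (hopen _ (basicOpen r).isOpen)
    rcases hC with hC | hC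
    · convert hr'.union hlc using 1
      ext q
      have := hC q
      simp only [Set.mem_inter_iff, Set.mem_union, mem_sup, mem_I, SetLike.mem_coe,
        mem_basicOpen, ← asIdeal_le_asIdeal] at this ⊢
      tauto
    · convert hr' using 1
      ext q
      have := hC q
      simp only [Set.mem_inter_iff, mem_sup, mem_I, ← asIdeal_le_asIdeal] at this ⊢
      tauto
  -- As `x * y ∈ I`, `V(I)` is the union of the smaller sets `V(I + (x))` and `V(I + (y))`.
  · obtain ⟨x, hx, y, hy, hxy⟩ := (Ideal.not_isPrime_iff.1 hp).resolve_left htop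
    convert (ih _ (lt_sup hx)).union (ih _ (lt_sup hy)) using 1
    ext q
    have h1 (hq : I ≤ q.asIdeal) := q.isPrime.mem_or_mem (hq hxy)
    simp only [Set.mem_inter_iff, Set.mem_union, mem_sup, mem_I]
    tauto

/-! ### Functionals on finitely generated algebras. -/

theorem IsFractionRing.exists_finset_subset_range_liftAlgHom {A E : Type*} [CommRing A] [IsDomain A]
    [Field E] [Algebra A E] [IsFractionRing A E] (F : Finset E) :
    ∃ a : A, a ≠ 0 ∧ ∃ φ : Localization.Away a →ₐ[A] E, Function.Injective φ ∧
      ∀ x ∈ F, x ∈ φ.range := by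
  obtain ⟨⟨a, ha⟩, h⟩ := IsLocalization.exist_integer_multiples_of_finset (nonZeroDivisors A) F
  have ha0 : a ≠ 0 := nonZeroDivisors.ne_zero ha
  have haE : algebraMap A E a ≠ 0 := by simpa using ha0
  have hu (y : Submonoid.powers a) : IsUnit (Algebra.ofId A E y) := by
    obtain ⟨_, n, rfl⟩ := y
    simpa [Algebra.ofId_apply] using fun h ↦ absurd h ha0
  refine ⟨a, ha0, IsLocalization.liftAlgHom (M := Submonoid.powers a) hu, ?_, fun x hx ↦ ?_⟩
  · refine (IsLocalization.lift_injective_iff (M := Submonoid.powers a) _).2 fun x y ↦ ?_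
    rw [(IsLocalization.injective (Localization.Away a)
      (powers_le_nonZeroDivisors_of_noZeroDivisors ha0)).eq_iff]
    exact (IsFractionRing.injective A E).eq_iff.symm
  · obtain ⟨y, hy⟩ := h x hx
    refine ⟨IsLocalization.mk' _ y (⟨a, Submonoid.mem_powers a⟩ : Submonoid.powers a), ?_⟩
    simp only [AlgHom.toRingHom_eq_coe, RingHom.coe_coe, IsLocalization.liftAlgHom_apply]
    rw [IsLocalization.lift_mk'_spec]
    simpa [Algebra.smul_def, Algebra.ofId_apply] using hy

theorem MvPolynomial.exists_forall_coeff_mem_range {A E S σ : Type*} [CommRing A] [IsDomain A]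
    [Field E] [Algebra A E] [IsFractionRing A E] [CommRing S] [Algebra (MvPolynomial σ E) S]
    [Algebra A S] [IsScalarTower A (MvPolynomial σ E) S]
    [Module.Finite (MvPolynomial σ E) S] (μ : S →ₗ[MvPolynomial σ E] MvPolynomial σ E)
    (X : Finset S) :
    ∃ a : A, a ≠ 0 ∧ ∃ φ : Localization.Away a →ₐ[A] E, Function.Injective φ ∧
      ∀ s ∈ Algebra.adjoin A (X : Set S), ∀ m, (μ s).coeff m ∈ φ.range := by
  classical
  obtain ⟨w, hw⟩ := Module.Finite.fg_top (R := MvPolynomial σ E) (M := S)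
  have hc (v : S) : ∃ c : S → MvPolynomial σ E, ∑ j ∈ w, c j • j = v := by
    have hv : v ∈ Submodule.span (MvPolynomial σ E) (w : Set S) := hw ▸ Submodule.mem_top
    obtain ⟨c, -, hc⟩ := Submodule.mem_span_finset.1 hv
    exact ⟨c, hc⟩
  choose c hc using hc
  -- With these coefficients in `A_a`, the `A_a[σ]`-span of `w` contains 1, is stable under
  -- multiplication by `X`, and is sent by `μ` into `A_a[σ]`.
  let F : Finset E := (w.biUnion fun l ↦ (c 1 l).coeffs) ∪ (w.biUnion fun j ↦ (μ j).coeffs) ∪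
    X.biUnion fun x ↦ w.biUnion fun j ↦ w.biUnion fun l ↦ (c (x * j) l).coeffs
  obtain ⟨a, ha, φ, hφ, hF⟩ :=
    IsFractionRing.exists_finset_subset_range_liftAlgHom (A := A) F
  refine ⟨a, ha, φ, hφ, ?_⟩
  let PD : Subalgebra A (MvPolynomial σ E) := (mapAlgHom (σ := σ) φ.range.val).range
  have hPD (p : MvPolynomial σ E) : p ∈ PD ↔ ∀ m, p.coeff m ∈ φ.range := by
    rw [← Subalgebra.mem_toSubmodule, range_mapAlgHom, mem_coeffsIn]
    simp
  have hPD' (p : MvPolynomial σ E) (h : p.coeffs ⊆ F) : p ∈ PD := by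
    rw [hPD]
    intro m
    by_cases hm : p.coeff m = 0
    · rw [hm]; exact zero_mem _
    · exact hF _ (h (coeff_mem_coeffs m hm))
  let N : Submodule PD S := Submodule.span PD (w : Set S)
  have hN (v : S) (h : ∀ l ∈ w, c v l ∈ PD) : v ∈ N := by
    rw [← hc v]
    exact sum_mem fun l hl ↦ N.smul_mem (⟨c v l, h l hl⟩ : PD) (Submodule.subset_span hl)
  have hN1 : 1 ∈ N := hN 1 fun l hl ↦ hPD' _ fun y hy ↦ by
    simp only [F, Finset.mem_union, Finset.mem_biUnion]
    exact .inl (.inl ⟨l, hl, hy⟩)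
  have hmul (s : S) (hs : s ∈ Algebra.adjoin A (X : Set S)) : ∀ v ∈ N, s * v ∈ N := by
    induction hs using Algebra.adjoin_induction with
    | mem x hx =>
      intro v hv
      induction hv using Submodule.span_induction with
      | mem j hj =>
        refine hN _ fun l hl ↦ hPD' _ fun y hy ↦ ?_
        simp only [F, Finset.mem_union, Finset.mem_biUnion]
        exact .inr ⟨x, hx, j, hj, l, hl, hy⟩
      | zero => simp
      | add x y _ _ hx hy => rw [mul_add]; exact add_mem hx hy
      | smul p x _ hx => rw [mul_smul_comm]; exact N.smul_mem _ hx
    | algebraMap r =>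
      intro v hv
      rw [← Algebra.smul_def, ← algebraMap_smul (MvPolynomial σ E) r v]
      exact N.smul_mem (algebraMap A PD r) hv
    | add x y _ _ hx hy => intro v hv; rw [add_mul]; exact add_mem (hx v hv) (hy v hv)
    | mul x y _ _ hx hy => intro v hv; rw [mul_assoc]; exact hx _ (hy v hv)
  intro s hs
  have hsN : s ∈ N := by simpa using hmul s hs 1 hN1
  rw [← hPD]
  clear hs
  induction hsN using Submodule.span_induction with
  | mem j hj =>
    refine hPD' _ fun y hy ↦ ?_
    simp only [F, Finset.mem_union, Finset.mem_biUnion]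
    exact .inl (.inr ⟨j, hj, hy⟩)
  | zero => simp
  | add x y _ _ hx hy => rw [map_add]; exact add_mem hx hy
  | smul p x _ hx =>
    rw [Subalgebra.smul_def, map_smul]
    exact mul_mem p.2 hx

/-- Noether normalization makes the `E`-algebra generated by the image of `T` in `K` finite over a
polynomial ring. Take a functional `μ` there and extract a coefficient that is nonzero in `μ 1`. -/
theorem Algebra.FiniteType.exists_linearMap_localizationAway_of_isFractionRing
    {A T : Type*} (E K : Type*) [CommRing A] [IsDomain A] [CommRing T] [Algebra A T] [Algebra.FiniteType A T]
    [Field E] [Algebra A E] [IsFractionRing A E] [Field K] [Algebra T K] [Algebra A K]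
    [IsScalarTower A T K] [Algebra E K] [IsScalarTower A E K] :
    ∃ a : A, a ≠ 0 ∧ ∃ ν : T →ₗ[A] Localization.Away a, ν 1 ≠ 0 := by
  classical
  obtain ⟨X, hX⟩ := Algebra.FiniteType.out (R := A) (A := T)
  obtain ⟨S, hS⟩ : ∃ S : Subalgebra E K, S = Algebra.adjoin E (algebraMap T K '' X) := ⟨_, rfl⟩
  have : Algebra.FiniteType E S :=
    S.fg_iff_finiteType.1 (Subalgebra.fg_def.2 ⟨_, X.finite_toSet.image _, hS.symm⟩)
  have hTS (t : T) : algebraMap T K t ∈ S := by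
    have ht : t ∈ Algebra.adjoin A (X : Set T) := hX ▸ Algebra.mem_top
    induction ht using Algebra.adjoin_induction with
    | mem x hx => exact hS ▸ Algebra.subset_adjoin ⟨x, hx, rfl⟩
    | algebraMap r =>
      rw [← IsScalarTower.algebraMap_apply A T K, IsScalarTower.algebraMap_apply A E K]
      exact S.algebraMap_mem _
    | add x y _ _ hx hy => rw [map_add]; exact add_mem hx hy
    | mul x y _ _ hx hy => rw [map_mul]; exact mul_mem hx hy
  let ι : T →ₐ[A] S := (IsScalarTower.toAlgHom A T K).codRestrict (S.restrictScalars A) hTS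
  obtain ⟨n, g, hg, hfin⟩ := exists_finite_inj_algHom_of_fg E S
  let : Algebra (MvPolynomial (Fin n) E) S := g.toRingHom.toAlgebra
  have : Module.Finite (MvPolynomial (Fin n) E) S := hfin
  have : IsScalarTower E (MvPolynomial (Fin n) E) S := .of_algebraMap_eq fun x ↦ (g.commutes x).symm
  have : IsScalarTower A (MvPolynomial (Fin n) E) S := .of_algebraMap_eq fun x ↦ by
    rw [IsScalarTower.algebraMap_apply A E S, IsScalarTower.algebraMap_apply E
      (MvPolynomial (Fin n) E) S, ← IsScalarTower.algebraMap_apply A E]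
  have : FaithfulSMul (MvPolynomial (Fin n) E) S :=
    (faithfulSMul_iff_algebraMap_injective _ _).2 hg
  obtain ⟨μ, hμ⟩ := LinearMap.exists_dual_apply_one_ne_zero (P := MvPolynomial (Fin n) E) (S := S)
  obtain ⟨m, hm⟩ := MvPolynomial.ne_zero_iff.1 hμ
  obtain ⟨a, ha, φ, hφ, hcoeff⟩ :=
    MvPolynomial.exists_forall_coeff_mem_range (A := A) μ (X.image ι)
  let ν : T →ₗ[A] E := (MvPolynomial.lcoeff E m).restrictScalars A ∘ₗ
    μ.restrictScalars A ∘ₗ ι.toLinearMap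
  have hν (t : T) : ν t ∈ LinearMap.range φ.toLinearMap := by
    refine hcoeff (ι t) ?_ m
    have ht : t ∈ Algebra.adjoin A (X : Set T) := hX ▸ Algebra.mem_top
    rw [Finset.coe_image, ← AlgHom.map_adjoin]
    exact ⟨t, ht, rfl⟩
  refine ⟨a, ha, (LinearEquiv.ofInjective φ.toLinearMap hφ).symm.toLinearMap ∘ₗ
    ν.codRestrict _ hν, ?_⟩
  simp only [LinearMap.comp_apply, LinearEquiv.coe_coe, ne_eq, LinearEquiv.map_eq_zero_iff]
  intro h
  refine hm ?_
  have := congrArg Subtype.val h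
  simpa [ν] using this

theorem Algebra.FiniteType.exists_linearMap_localizationAway {A T : Type*} [CommRing A] [IsDomain A]
    [CommRing T] [IsDomain T] [Algebra A T] [Algebra.FiniteType A T] [FaithfulSMul A T] :
    ∃ a : A, a ≠ 0 ∧ ∃ ν : T →ₗ[A] Localization.Away a, ν 1 ≠ 0 :=
  let _ : Algebra (FractionRing A) (FractionRing T) := FractionRing.liftAlgebra A (FractionRing T)
  have : IsScalarTower A (FractionRing A) (FractionRing T) :=
    FractionRing.isScalarTower_liftAlgebra A (FractionRing T)
  exists_linearMap_localizationAway_of_isFractionRing (FractionRing A) (FractionRing T)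

/-! ### Nonzero elements and nonzerodivisors under specialization. -/

theorem TensorProduct.exists_ne_zero_forall_rTensor_ne_zero.{uL, uk, uR, uV} {k : Type uk}
    {R : Type uR} {V : Type uV} [Field k]
    [CommRing R] [Algebra k R] [AddCommGroup V] [Module k V] {z : R ⊗[k] V} (hz : z ≠ 0) :
    ∃ r : R, r ≠ 0 ∧ ∀ (L : Type uL) [CommRing L] [Algebra k L] (f : R →ₐ[k] L), f r ≠ 0 →
      f.toLinearMap.rTensor V z ≠ 0 := by
  classical
  let b := Module.Basis.ofVectorSpace k V
  have hz' : equivFinsuppOfBasisRight b z ≠ 0 := by simpa using hz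
  obtain ⟨i, hi⟩ := Finsupp.ne_iff.1 hz'
  refine ⟨_, hi, fun L _ _ f hf h ↦ hf ?_⟩
  have key (y : R ⊗[k] V) : equivFinsuppOfBasisRight b (f.toLinearMap.rTensor V y) i =
      f (equivFinsuppOfBasisRight b y i) := by
    induction y with
    | zero => simp
    | add x y hx hy => simp [hx, hy]
    | tmul x y => simp
  rw [← key, h]
  simp

theorem RingHom.Flat.of_injective {P K : Type*} [CommRing P] [IsDomain P] [Field K] {f : P →+* K}
    (hf : Function.Injective f) : f.Flat := by
  have heq : f = (IsFractionRing.lift hf : FractionRing P →+* K).comp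
      (algebraMap P (FractionRing P)) := by
    ext x
    exact (IsFractionRing.lift_algebraMap hf x).symm
  rw [heq]
  exact .comp (RingHom.flat_algebraMap_iff.2 inferInstance) (.of_isField (Field.toIsField _) _)

theorem RingHom.Flat.map_mem_nonZeroDivisors {R S : Type*} [CommRing R] [CommRing S] {f : R →+* S}
    (hf : f.Flat) {x : R} (hx : x ∈ nonZeroDivisors R) : f x ∈ nonZeroDivisors S := by
  algebraize [f]
  have hx' : IsSMulRegular R x := (isSMulRegular_iff_right_eq_zero_of_smul).2 fun y hy ↦
    (mul_left_mem_nonZeroDivisors_eq_zero_iff hx).1 hy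
  rw [mem_nonZeroDivisors_iff_right]
  intro y hy
  exact (isSMulRegular_iff_right_eq_zero_of_smul).1
    (IsSMulRegular.of_flat (S := S) hx') y (by rwa [smul_eq_mul, mul_comm])

/-- Although `g` need not be flat, its composite `P → Frac B` is, and `L ⊗ B` embeds in `L ⊗ Frac
B`. -/
theorem Algebra.TensorProduct.lTensor_mem_nonZeroDivisors {k P B L : Type*} [Field k]
    [CommRing P] [IsDomain P] [Algebra k P] [CommRing B] [IsDomain B] [Algebra k B]
    [CommRing L] [Algebra k L] {g : P →ₐ[k] B} (hg : Function.Injective g)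
    {c : L ⊗[k] P} (hc : c ∈ nonZeroDivisors (L ⊗[k] P)) :
    map (AlgHom.id k L) g c ∈ nonZeroDivisors (L ⊗[k] B) := by
  let u : B →ₐ[k] FractionRing B := IsScalarTower.toAlgHom k B _
  have hu : Function.Injective u := IsFractionRing.injective B _
  have hreg := ((RingHom.Flat.of_injective (f := (u.comp g).toRingHom) (hu.comp hg)).lTensor
    (S := k) (A := L) (f := u.comp g)).map_mem_nonZeroDivisors hc
  have hmap : Function.Injective (map (AlgHom.id k L) u) :=
    Module.Flat.lTensor_preserves_injective_linearMap (M := L) u.toLinearMap hu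
  have hcomp (x : L ⊗[k] P) : Algebra.TensorProduct.lTensor (S := k) L (u.comp g) x =
      map (AlgHom.id k L) u (map (AlgHom.id k L) g x) := by
    induction x with
    | zero => simp
    | add x y hx hy => simp only [map_add, hx, hy]
    | tmul x y => simp
  rw [mem_nonZeroDivisors_iff_right]
  intro x hx
  refine (map_eq_zero_iff _ hmap).1 ((mul_right_mem_nonZeroDivisors_eq_zero_iff hreg).1 ?_)
  change _ * Algebra.TensorProduct.lTensor (S := k) L (u.comp g) c = 0
  rw [hcomp, ← map_mul, hx, map_zero]

/-- `L ⊗ B` need not be a domain, but `L ⊗ k[Y]` is one, where `k[Y] → B` is a Noether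
normalization. By integrality `a` divides a nonzero `c ∈ R ⊗ k[Y]`, and it suffices to keep `c`
nonzero. -/
theorem Algebra.TensorProduct.exists_forall_map_mem_nonZeroDivisors.{uL, uk, uR, uB} {k : Type uk}
    {R : Type uR} {B : Type uB} [Field k] [CommRing R] [Nontrivial R] [Algebra k R] [CommRing B]
    [IsDomain B] [Algebra k B] [Algebra.FiniteType k B] {a : R ⊗[k] B} (ha : a ∈ nonZeroDivisors (R ⊗[k] B)) :
    ∃ r : R, r ≠ 0 ∧ ∀ (L : Type uL) [Field L] [Algebra k L] (f : R →ₐ[k] L), f r ≠ 0 →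
      map f (AlgHom.id k B) a ∈ nonZeroDivisors (L ⊗[k] B) := by
  obtain ⟨s, g, hg, hfin⟩ := exists_finite_inj_algHom_of_fg k B
  let G : R ⊗[k] MvPolynomial (Fin s) k →ₐ[k] R ⊗[k] B := map (AlgHom.id k R) g
  let := G.toRingHom.toAlgebra
  have hG : IsIntegral (R ⊗[k] MvPolynomial (Fin s) k) a :=
    (RingHom.Finite.tensorProductMap (f := AlgHom.id k R) (g := g)
      (RingHom.Finite.id R) hfin).to_isIntegral a
  have : Nontrivial (R ⊗[k] MvPolynomial (Fin s) k) :=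
    (MvPolynomial.algebraTensorAlgEquiv k R (σ := Fin s)).toEquiv.nontrivial
  obtain ⟨c, hc, y, hy⟩ := hG.isAlgebraic.exists_nonzero_dvd ha
  obtain ⟨r, hr, hL⟩ := TensorProduct.exists_ne_zero_forall_rTensor_ne_zero.{uL} hc
  refine ⟨r, hr, fun L _ _ f hf ↦ ?_⟩
  have : IsDomain (L ⊗[k] MvPolynomial (Fin s) k) :=
    (MvPolynomial.algebraTensorAlgEquiv k L (σ := Fin s)).toMulEquiv.isDomain _
  have hcL := lTensor_mem_nonZeroDivisors (L := L) hg (mem_nonZeroDivisors_of_ne_zero (hL L f hf))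
  have hcomm (c) : map f (AlgHom.id k B) (G c) =
      map (AlgHom.id k L) g (f.toLinearMap.rTensor (MvPolynomial (Fin s) k) c) := by
    induction c with
    | zero => simp
    | add x y hx hy => simp only [map_add, hx, hy]
    | tmul x y => simp [G]
  rw [← hcomm, show G c = a * y from hy, map_mul] at hcL
  exact (mul_mem_nonZeroDivisors.1 hcL).1

/-! ### The generic dichotomy. -/

theorem exists_forall_injective_lift_mapAlgHom.{uL, uk, uR, uB} {k : Type uk} {R : Type uR}
    {B : Type uB} {σ : Type*} [Finite σ] [Field k] [CommRing R] [IsDomain R] [Algebra k R]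
    [CommRing B] [IsDomain B] [Algebra k B] [Algebra.FiniteType k B]
    (Ψ : B →ₐ[k] MvPolynomial σ R)
    (hΨ : Function.Injective (Algebra.TensorProduct.lift
      (Algebra.ofId R (MvPolynomial σ R)) Ψ fun _ _ ↦ Commute.all _ _)) :
    ∃ r : R, r ≠ 0 ∧ ∀ (L : Type uL) [Field L] [Algebra k L] (f : R →ₐ[k] L), f r ≠ 0 →
      Function.Injective (Algebra.TensorProduct.lift (Algebra.ofId L (MvPolynomial σ L))
        ((MvPolynomial.mapAlgHom f).comp Ψ) fun _ _ ↦ Commute.all _ _) := by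
  set Φ := Algebra.TensorProduct.lift
      (Algebra.ofId R (MvPolynomial σ R)) Ψ fun _ _ ↦ Commute.all _ _
  have : IsDomain (R ⊗[k] B) := hΨ.isDomain Φ.toRingHom
  let : Algebra (R ⊗[k] B) (MvPolynomial σ R) := Φ.toRingHom.toAlgebra
  have hsmul (x : R ⊗[k] B) (t : MvPolynomial σ R) : x • t = Φ x * t := rfl
  have : IsScalarTower R (R ⊗[k] B) (MvPolynomial σ R) :=
    .of_algebraMap_eq fun x ↦ (Φ.commutes x).symm
  have : Algebra.FiniteType (R ⊗[k] B) (MvPolynomial σ R) :=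
    .of_restrictScalars_finiteType R _ _
  have : FaithfulSMul (R ⊗[k] B) (MvPolynomial σ R) :=
    (faithfulSMul_iff_algebraMap_injective _ _).2 hΨ
  obtain ⟨a, ha, ν, hν⟩ := Algebra.FiniteType.exists_linearMap_localizationAway
    (A := R ⊗[k] B) (T := MvPolynomial σ R)
  -- Thus `ν 1 = b / a ^ n`.
  obtain ⟨⟨b, ⟨_, n, rfl⟩⟩, hb⟩ := IsLocalization.surj (Submonoid.powers a) (ν 1)
  have hb0 : b ≠ 0 := by
    rintro rfl
    exact hν ((IsLocalization.map_units (Localization.Away a)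
      (⟨a ^ n, n, rfl⟩ : Submonoid.powers a)).mul_left_eq_zero.1 (hb.trans (map_zero _)))
  obtain ⟨r, hr, hL⟩ := Algebra.TensorProduct.exists_forall_map_mem_nonZeroDivisors.{uL}
    (mem_nonZeroDivisors_of_ne_zero (mul_ne_zero ha hb0))
  refine ⟨r, hr, fun L _ _ f hf ↦ ?_⟩
  let φ : R ⊗[k] B →ₐ[k] L ⊗[k] B := Algebra.TensorProduct.map f (AlgHom.id k B)
  have hab := hL L f hf
  rw [map_mul, mul_mem_nonZeroDivisors] at hab
  let Ma := Localization.Away (φ a)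
  let φa : Localization.Away a →+* Ma := Localization.awayMap φ.toRingHom a
  have hφa (x : R ⊗[k] B) : φa (algebraMap _ _ x) = algebraMap _ Ma (φ x) :=
    IsLocalization.map_eq _ _
  have hφa_smul (x : R ⊗[k] B) (y : Localization.Away a) :
      φa (x • y) = algebraMap _ Ma (φ x) * φa y := by
    rw [Algebra.smul_def x y, map_mul, hφa]
  -- The base change of `ν` to `L`, prescribed on the monomial basis.
  let θ : MvPolynomial σ L →ₗ[L] Ma :=
    (MvPolynomial.basisMonomials σ L).constr L fun m ↦ φa (ν (MvPolynomial.monomial m 1))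
  have hθ (t : MvPolynomial σ R) : θ (MvPolynomial.map f.toRingHom t) = φa (ν t) := by
    induction t using MvPolynomial.induction_on' with
    | add p q hp hq => simp only [map_add, hp, hq]
    | monomial m c =>
      have h1 : MvPolynomial.monomial m c =
          (c ⊗ₜ[k] (1 : B)) • MvPolynomial.monomial m (1 : R) := by
        simp [hsmul, Φ, Algebra.ofId_apply, MvPolynomial.C_mul_monomial,
          MvPolynomial.algebraMap_eq]
      have h2 : MvPolynomial.map f.toRingHom (MvPolynomial.monomial m c) =
          f c • MvPolynomial.basisMonomials σ L m := by
        simp [MvPolynomial.smul_monomial]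
      rw [h2, map_smul, Module.Basis.constr_basis, h1, map_smul, hφa_smul, Algebra.smul_def]
      congr 1
  set Φ' := Algebra.TensorProduct.lift (Algebra.ofId L (MvPolynomial σ L))
        ((MvPolynomial.mapAlgHom f).comp Ψ) fun _ _ ↦ Commute.all _ _
  have hθΦ (z : L ⊗[k] B) : θ (Φ' z) = algebraMap _ Ma z * φa (ν 1) := by
    induction z with
    | zero => simp
    | add x y hx hy => simp only [map_add, hx, hy, add_mul]
    | tmul l x =>
      have h1 : Φ' (l ⊗ₜ x) = l • MvPolynomial.map f.toRingHom (Ψ x) := by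
        simp [Φ', Algebra.ofId_apply, Algebra.smul_def]
      have h2 : Ψ x = ((1 : R) ⊗ₜ[k] x) • (1 : MvPolynomial σ R) := by
        simp [hsmul, Φ]
      rw [h1, map_smul, hθ, h2, map_smul, hφa_smul, Algebra.smul_def,
        ← mul_assoc, IsScalarTower.algebraMap_apply L (L ⊗[k] B) Ma, ← map_mul]
      simp [φ]
  rw [injective_iff_map_eq_zero]
  intro z hz
  have h0 : algebraMap _ Ma z * φa (ν 1) = 0 := by rw [← hθΦ, hz, map_zero]
  have hinj' : Function.Injective (algebraMap (L ⊗[k] B) Ma) :=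
    IsLocalization.injective Ma (Submonoid.powers_le.2 hab.1)
  have h1 : algebraMap _ Ma (z * φ b) = 0 := by
    rw [map_mul, ← hφa, ← hb, map_mul, ← mul_assoc, h0, zero_mul]
  exact (mul_right_mem_nonZeroDivisors_eq_zero_iff hab.2).1
    ((map_eq_zero_iff _ hinj').1 h1)

theorem exists_forall_injective_or_forall_not_injective.{uL, uk, uR, uB} {k : Type uk} {R : Type uR}
    {B : Type uB} {σ : Type*} [Finite σ] [Field k] [CommRing R] [IsDomain R] [Algebra k R]
    [CommRing B] [IsDomain B] [Algebra k B] [Algebra.FiniteType k B]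
    (Ψ : B →ₐ[k] MvPolynomial σ R) :
    ∃ r : R, r ≠ 0 ∧
      ((∀ (L : Type uL) [Field L] [Algebra k L] (f : R →ₐ[k] L), f r ≠ 0 →
        Function.Injective (Algebra.TensorProduct.lift (Algebra.ofId L (MvPolynomial σ L))
          ((MvPolynomial.mapAlgHom f).comp Ψ) fun _ _ ↦ Commute.all _ _)) ∨
      (∀ (L : Type uL) [Field L] [Algebra k L] (f : R →ₐ[k] L), f r ≠ 0 →
        ¬ Function.Injective (Algebra.TensorProduct.lift (Algebra.ofId L (MvPolynomial σ L))
          ((MvPolynomial.mapAlgHom f).comp Ψ) fun _ _ ↦ Commute.all _ _))) := by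
  by_cases hΨ : Function.Injective (Algebra.TensorProduct.lift
      (Algebra.ofId R (MvPolynomial σ R)) Ψ fun _ _ ↦ Commute.all _ _)
  · obtain ⟨r, hr, h⟩ := exists_forall_injective_lift_mapAlgHom.{uL} Ψ hΨ
    exact ⟨r, hr, .inl h⟩
  · rw [injective_iff_map_eq_zero] at hΨ
    push Not at hΨ
    obtain ⟨z, hz, hz0⟩ := hΨ
    obtain ⟨r, hr, h⟩ := TensorProduct.exists_ne_zero_forall_rTensor_ne_zero.{uL} hz0
    refine ⟨r, hr, .inr fun L _ _ f hf hinj ↦ h L f hf (hinj ?_)⟩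
    have key (y : R ⊗[k] B) : Algebra.TensorProduct.lift (Algebra.ofId L (MvPolynomial σ L))
          ((MvPolynomial.mapAlgHom f).comp Ψ) (fun _ _ ↦ Commute.all _ _)
          (f.toLinearMap.rTensor B y) = MvPolynomial.mapAlgHom f (Algebra.TensorProduct.lift
            (Algebra.ofId R (MvPolynomial σ R)) Ψ (fun _ _ ↦ Commute.all _ _) y) := by
      induction y with
      | zero => simp
      | add x y hx hy => simp only [map_add, hx, hy]
      | tmul x y => simp [Algebra.ofId_apply, MvPolynomial.algebraMap_eq]
    rw [key, hz, map_zero, map_zero]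

/-! ### Part (a). -/

theorem isConstructible_polynomialEmbeddingLocus {k B R : Type*} [Field k]
    [CommRing B] [IsDomain B] [Algebra k B] [Algebra.FiniteType k B]
    [CommRing R] [Algebra k R] [IsNoetherianRing R]
    {N : ℕ} (Ψ : B →ₐ[k] MvPolynomial (Fin N) R) :
    Topology.IsConstructible (polynomialEmbeddingLocus Ψ) := by
  refine PrimeSpectrum.isConstructible_of_forall_exists_basicOpen _ fun p ↦ ?_
  obtain ⟨r', hr', h⟩ := exists_forall_injective_or_forall_not_injective
    ((MvPolynomial.mapAlgHom (Ideal.Quotient.mkₐ k p.asIdeal)).comp Ψ)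
  obtain ⟨r, rfl⟩ := Ideal.Quotient.mkₐ_surjective k p.asIdeal r'
  have hmk (x : R) : Ideal.Quotient.mkₐ k p.asIdeal x = 0 ↔ x ∈ p.asIdeal :=
    Ideal.Quotient.eq_zero_iff_mem
  have hmem (q : PrimeSpectrum R) (hpq : p ≤ q) (hrq : r ∉ q.asIdeal) :
      ∃ f : (R ⧸ p.asIdeal) →ₐ[k] q.asIdeal.ResidueField,
        f (Ideal.Quotient.mkₐ k p.asIdeal r) ≠ 0 ∧
        (q ∈ polynomialEmbeddingLocus Ψ ↔ Function.Injective (Algebra.TensorProduct.lift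
          (Algebra.ofId q.asIdeal.ResidueField (MvPolynomial (Fin N) q.asIdeal.ResidueField))
          ((MvPolynomial.mapAlgHom f).comp ((MvPolynomial.mapAlgHom
            (Ideal.Quotient.mkₐ k p.asIdeal)).comp Ψ)) fun _ _ ↦ Commute.all _ _)) := by
    let f : (R ⧸ p.asIdeal) →ₐ[k] q.asIdeal.ResidueField :=
      Ideal.Quotient.liftₐ p.asIdeal (IsScalarTower.toAlgHom k R q.asIdeal.ResidueField)
        fun a ha ↦ Ideal.algebraMap_residueField_eq_zero.2 (hpq ha)
    have hf : f.comp (Ideal.Quotient.mkₐ k p.asIdeal) =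
        IsScalarTower.toAlgHom k R q.asIdeal.ResidueField :=
      Ideal.Quotient.liftₐ_comp _ _ _
    refine ⟨f, ?_, ?_⟩
    · rw [← AlgHom.comp_apply, hf]
      exact fun h0 ↦ hrq (Ideal.algebraMap_residueField_eq_zero.1 h0)
    · have : fiberHom Ψ q = (MvPolynomial.mapAlgHom f).comp ((MvPolynomial.mapAlgHom
            (Ideal.Quotient.mkₐ k p.asIdeal)).comp Ψ) := by
        ext1 b
        simp [fiberHom, ← hf, MvPolynomial.map_map]
        rfl
      simp only [← this]
      rfl
  refine ⟨r, fun hr ↦ hr' ((hmk r).2 hr), h.imp (fun h q hpq hrq ↦ ?_) fun h q hpq hrq ↦ ?_⟩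
  · obtain ⟨f, hfr, hiff⟩ := hmem q hpq hrq
    exact hiff.2 (h _ f hfr)
  · obtain ⟨f, hfr, hiff⟩ := hmem q hpq hrq
    exact fun hq ↦ h _ f hfr (hiff.1 hq)

/-! ### Part (b). -/

/-- `L` may lie in another universe than `k`; embedding it in `AlgebraicClosure k` brings the
definition to bear. -/
theorem IsGeometricallyIntegralAlgebra.isDomain_tensorProduct {k B L : Type*} [Field k] [CommRing B]
    [Algebra k B] (hB : IsGeometricallyIntegralAlgebra k B) [Field L] [Algebra k L]
    [Algebra.IsAlgebraic k L] : IsDomain (L ⊗[k] B) := by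
  have := hB (AlgebraicClosure k)
  let i : L →ₐ[k] AlgebraicClosure k := IsAlgClosed.lift
  have hi : Function.Injective (Algebra.TensorProduct.map i (AlgHom.id k B)) :=
    Module.Flat.rTensor_preserves_injective_linearMap (M := B) i.toLinearMap i.injective
  exact hi.isDomain (Algebra.TensorProduct.map i (AlgHom.id k B)).toRingHom

theorem fiberHomHat_one_tmul {k B R : Type*} [Field k] [CommRing B] [Algebra k B]
    [CommRing R] [Algebra k R] {N : ℕ} (Ψ : B →ₐ[k] MvPolynomial (Fin N) R) (p : PrimeSpectrum R)
    (b : B) : fiberHomHat Ψ p (1 ⊗ₜ b) = fiberHom Ψ p b := by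
  simp [fiberHomHat]

theorem mem_polynomialEmbeddingLocus_iff_of_isMaximal {k B R : Type*} [Field k]
    [CommRing B] [Algebra k B] [CommRing R] [Algebra k R] [Algebra.FiniteType k R]
    {N : ℕ} (Ψ : B →ₐ[k] MvPolynomial (Fin N) R) (hB : IsGeometricallyIntegralAlgebra k B)
    (m : PrimeSpectrum R) (hm : m.asIdeal.IsMaximal) :
    m ∈ polynomialEmbeddingLocus Ψ ↔ Function.Injective (fiberHom Ψ m) := by
  let κ := m.asIdeal.ResidueField
  have hincl : Function.Injective (Algebra.TensorProduct.includeRight : B →ₐ[k] κ ⊗[k] B) :=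
    Algebra.TensorProduct.includeRight_injective (algebraMap k κ).injective
  have hcomp (b : B) := fiberHomHat_one_tmul Ψ m b
  refine ⟨fun h x y hxy ↦ hincl (h ?_), fun h ↦ ?_⟩
  · simpa [hcomp] using hxy
  have : Algebra.FiniteType k κ := by
    have : Function.Surjective (IsScalarTower.toAlgHom k R κ) :=
      Ideal.algebraMap_residueField_surjective m.asIdeal
    exact Algebra.FiniteType.of_surjective _ this
  have : Module.Finite k κ := finite_of_finite_type_of_isJacobsonRing k κ
  have : IsDomain (κ ⊗[k] B) := hB.isDomain_tensorProduct
  let := Algebra.TensorProduct.rightAlgebra (R := k) (A := κ) (B := B)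
  have htower : IsScalarTower k B (κ ⊗[k] B) := Algebra.TensorProduct.right_isScalarTower
  have : Algebra.IsIntegral B (κ ⊗[k] B) := by
    refine ⟨fun z ↦ ?_⟩
    induction z with
    | zero => exact isIntegral_zero
    | add x y hx hy => exact hx.add hy
    | tmul x b =>
      have h1 : IsIntegral B (x ⊗ₜ[k] (1 : B)) :=
        ((Algebra.IsIntegral.isIntegral (R := k) x).map
          (Algebra.TensorProduct.includeLeft (S := k) : κ →ₐ[k] κ ⊗[k] B)).tower_top
      have h2 : IsIntegral B ((1 : κ) ⊗ₜ[k] b) := isIntegral_algebraMap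
      simpa using h1.mul h2
  have : Nontrivial B :=
    (Algebra.TensorProduct.includeRight : B →ₐ[k] κ ⊗[k] B).toRingHom.domain_nontrivial
  refine (RingHom.injective_iff_ker_eq_bot _).2 (Ideal.eq_bot_of_comap_eq_bot (R := B) ?_)
  rw [eq_bot_iff]
  intro b hb
  refine h ?_
  rw [map_zero, ← hcomp]
  exact hb

theorem mainTheorem2 {k B R : Type*} [Field k]
    [CommRing B] [IsDomain B] [Algebra k B] [Algebra.FiniteType k B]
    [CommRing R] [IsDomain R] [Algebra k R] [Algebra.FiniteType k R]
    (N : ℕ) (Ψ : B →ₐ[k] MvPolynomial (Fin N) R) :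
    Topology.IsConstructible (polynomialEmbeddingLocus Ψ) ∧
      (IsGeometricallyIntegralAlgebra k B →
        ∀ m : PrimeSpectrum R, m.asIdeal.IsMaximal →
          (m ∈ polynomialEmbeddingLocus Ψ ↔ Function.Injective (fiberHom Ψ m))) := by
  have : IsNoetherianRing R := Algebra.FiniteType.isNoetherianRing k R
  exact ⟨isConstructible_polynomialEmbeddingLocus Ψ, fun hB m hm ↦
    mem_polynomialEmbeddingLocus_iff_of_isMaximal Ψ hB m hm⟩
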